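/- Let $p>3$ be a prime and let $d\neq 0$ be a rational number whose numerator (in lowest terms) is not divisible by $p$. For an integer $a$ put $q_p(a)=\frac{a^{p-1}-1}{p}$. For rational numbers $a,b$ write $a\equiv b\pmod{p^4}$ if $a-b=p^4c$ for some rational number $c$ whose denominator is not divisible by $p$. Then \begin{align*} \sum_{k=0}^{p-1}\left(1+(4-d)k^2+\frac{8+d}{2}k\right)\frac{\binom{2k}{k}}{d^k}&\equiv \left(\frac{16}{d}\right)^{p-1}\left(p(2p-1)(1-4p\,q_p(2))-10p^3q_p(2)^2\right)\pmod{p^4},\\ \sum_{k=0}^{p-1}\left(1+\frac{27-4d}{6}k^2+\frac{27+2d}{6}k\right)\frac{\binom{3k}{k}}{d^k}&\equiv \left(-\frac{27}{d}\right)^{p-1}p\left((2p-1)(1-3p\,q_p(3))-6p^2q_p(3)^2\right)\pmod{p^4},\\ \sum_{k=0}^{p-1}\left(1+\frac{16-d}{3}k^2+\frac{32+d}{6}k\right)\frac{\binom{4k}{2k}}{d^k}&\equiv \left(-\frac{64}{d}\right)^{p-1}p\left((2p-1)(1-6p\,q_p(2))-21p^2q_p(2)^2\right)\pmod{p^4},\\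 \sum_{k=0}^{p-1}\left(1+\frac{108-d}{15}k^2+\frac{216+d}{30}k\right)\frac{\binom{3k}{k}\binom{6k}{3k}}{d^k\binom{2k}{k}}&\equiv \left(-\frac{432}{d}\right)^{p-1}p\Bigl((2p-1)(1-4p\,q_p(2)-3p\,q_p(3))\\ &\qquad-2p^2\bigl(5q_p(2)^2+6q_p(2)q_p(3)+3q_p(3)^2\bigr)\Bigr)\pmod{p^4}. \end{align*} -/

import Mathlib

/-- The Fermat quotient `q_p(a) = (a ^ (p - 1) - 1) / p`, as a rational number. -/
def fermatQuotient (p : ℕ) (a : ℤ) : ℚ :=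
  ((a : ℚ) ^ (p - 1) - 1) / p

/-- Congruence of rational numbers modulo `p ^ n` (for a prime `p`): the difference lies in
`p ^ n ℤ_(p)`, where `ℤ_(p)` is the ring of rationals whose denominator is not divisible
by `p`. -/
def RatModPow (p n : ℕ) (a b : ℚ) : Prop :=
  ∃ c : ℚ, ¬ p ∣ c.den ∧ a - b = (p : ℚ) ^ n * c

/-! Each sum telescopes: for every n, the sum over k < n equals n(2n-1) d^(1-n) B(n)/B(1), where
B(k) is the binomial factor of the summand and B(1) = 2, 3, 6, 30. At n = p,
`exists_factorial_mul_eq`, a form of Wolstenholme's theorem, gives B(p)/B(1) ≡ 1 mod p^3, and the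
prefactor p raises this to p^4. So each sum is p(2p-1) d^(1-p) mod p^4. On the right, 16, 27, 64 and
432 are products of powers of 2 and 3, so their (p-1)-th powers are polynomials in p times Fermat
quotients; the remaining factor is the inverse of that polynomial times 2p-1, truncated
(`ratModPow_four_of_expansion`). -/

open Polynomial in
/-- The polynomial `(X + 1) (X + 2) ⋯ (X + n)` over the integers. -/
noncomputable def risingProd (n : ℕ) : ℤ[X] :=
  ∏ i ∈ Finset.range n, (X + C ((i : ℤ) + 1))

open Polynomial in
theorem Polynomial.eval_eq_cubic_expansion (f : ℤ[X]) :
    ∃ g : ℤ[X], ∀ x : ℤ,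
      f.eval x = f.coeff 0 + f.coeff 1 * x + f.coeff 2 * x ^ 2 + x ^ 3 * g.eval x := by
  refine ⟨f.divX.divX.divX, fun x => ?_⟩
  have h0 := congrArg (eval x) (divX_mul_X_add f)
  have h1 := congrArg (eval x) (divX_mul_X_add f.divX)
  have h2 := congrArg (eval x) (divX_mul_X_add f.divX.divX)
  simp only [eval_add, eval_mul, eval_X, eval_C, coeff_divX, zero_add] at h0 h1 h2
  norm_num at h0 h1 h2
  rw [← h0, ← h1, ← h2]
  ring

/-! ### Wolstenholme's theorem and factorials of multiples of p -/

open Polynomial in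
theorem risingProd_map_zmod (p : ℕ) [hp : Fact p.Prime] :
    (risingProd (p - 1)).map (Int.castRingHom (ZMod p)) = X ^ (p - 1) - 1 := by
  have hp1 : 1 ≤ p - 1 := by have := hp.out.two_le; omega
  have hmap : (risingProd (p - 1)).map (Int.castRingHom (ZMod p)) =
      ∏ i ∈ Finset.range (p - 1), (X + C (((i : ZMod p) + 1))) := by
    simp [risingProd, Polynomial.map_prod]
  rw [hmap]
  have hm : (∏ i ∈ Finset.range (p - 1), (X + C (((i : ZMod p) + 1)))).Monic :=
    monic_prod_of_monic _ _ fun i _ => monic_X_add_C _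
  have hd : (∏ i ∈ Finset.range (p - 1), (X + C (((i : ZMod p) + 1)))).degree =
      ((p - 1 : ℕ) : WithBot ℕ) := by
    rw [degree_prod]; simp [-map_add]
  have hd' : (X ^ (p - 1) - 1 : (ZMod p)[X]).degree = ((p - 1 : ℕ) : WithBot ℕ) := by
    have := degree_X_pow_sub_C (R := ZMod p) hp1 1
    simpa using this
  have hm' : (X ^ (p - 1) - 1 : (ZMod p)[X]).Monic := by
    have := monic_X_pow_sub_C (R := ZMod p) 1 (n := p - 1) (by omega)
    simpa using this
  refine eq_of_degree_sub_lt_of_eval_finset_eq (Finset.univ.erase (0 : ZMod p)) ?_ ?_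
  · have hlt := degree_sub_lt_right (hd.trans hd'.symm) hm'.ne_zero
      (hm.leadingCoeff.trans hm'.leadingCoeff.symm)
    rw [hd'] at hlt
    simpa [Finset.card_erase_of_mem, ZMod.card] using hlt
  · intro x hx
    have hx0 : x ≠ 0 := by simpa using hx
    rw [eval_sub, eval_pow, eval_X, eval_one, ZMod.pow_card_sub_one_eq_one hx0, sub_self,
      eval_prod]
    have hn0 : (-x).val ≠ 0 := by simpa using hx0
    have hlt := ZMod.val_lt (-x)
    refine Finset.prod_eq_zero (i := (-x).val - 1) (by simp; omega) ?_
    rw [eval_add, eval_X, eval_C]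
    have : (((-x).val - 1 : ℕ) : ZMod p) + 1 = -x := by
      rw [← Nat.cast_succ, Nat.succ_eq_add_one, Nat.sub_add_cancel (by omega)]
      simp
    rw [this, add_neg_cancel]

open Polynomial in
theorem dvd_coeff_two_risingProd (p : ℕ) (hp : p.Prime) (hp3 : 3 < p) :
    (p : ℤ) ∣ (risingProd (p - 1)).coeff 2 := by
  have : Fact p.Prime := ⟨hp⟩
  rw [← ZMod.intCast_zmod_eq_zero_iff_dvd]
  have h := congrArg (fun f => f.coeff 2) (risingProd_map_zmod p)
  simp only [coeff_map, coeff_sub, coeff_X_pow, coeff_one] at h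
  rw [if_neg (by omega), if_neg (by omega), sub_zero] at h
  simpa using h

theorem risingProd_eval_natCast (n x : ℕ) :
    (risingProd n).eval (x : ℤ) = ((x + 1).ascFactorial n : ℕ) := by
  rw [Nat.ascFactorial_eq_prod_range, risingProd, Polynomial.eval_prod]
  push_cast
  refine Finset.prod_congr rfl fun i _ => ?_
  simp
  ring

theorem risingProd_eval_neg_succ (n : ℕ) (hn : Even n) :
    (risingProd n).eval (-((n : ℤ) + 1)) = (risingProd n).eval 0 := by
  simp only [risingProd, Polynomial.eval_prod]
  rw [← Finset.prod_range_reflect]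
  have h : ∀ i ∈ Finset.range n,
      (Polynomial.X + Polynomial.C (((n - 1 - i : ℕ) : ℤ) + 1)).eval (-((n : ℤ) + 1)) =
        (-1) * (Polynomial.X + Polynomial.C ((i : ℤ) + 1)).eval 0 := by
    intro i hi
    have := Finset.mem_range.mp hi
    have hc : ((n - 1 - i : ℕ) : ℤ) = n - 1 - i := by omega
    simp only [Polynomial.eval_add, Polynomial.eval_X, Polynomial.eval_C, hc]
    ring
  rw [Finset.prod_congr rfl h, Finset.prod_mul_distrib]
  simp [hn.neg_one_pow]

/-- The symmetry x ↦ -p - x gives f(-p) = f(0). Expanding at -p and dividing by p expresses the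
linear coefficient as p times the quadratic one, itself divisible by p, minus a multiple of p^2. -/
theorem sq_dvd_coeff_one_risingProd (p : ℕ) (hp : p.Prime) (hp3 : 3 < p) :
    (p : ℤ) ^ 2 ∣ (risingProd (p - 1)).coeff 1 := by
  obtain ⟨g, hg⟩ := (risingProd (p - 1)).eval_eq_cubic_expansion
  obtain ⟨t, ht⟩ := dvd_coeff_two_risingProd p hp hp3
  have he : Even (p - 1) := hp.even_sub_one (by omega)
  have h := risingProd_eval_neg_succ (p - 1) he
  have hc : ((p - 1 : ℕ) : ℤ) + 1 = p := by omega
  rw [hc, hg, hg 0, ht] at h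
  have hp0 : (p : ℤ) ≠ 0 := by exact_mod_cast hp.ne_zero
  refine ⟨t - g.eval (-(p : ℤ)), mul_left_cancel₀ hp0 ?_⟩
  linear_combination -h

/-- Wolstenholme's theorem in the form `C(np + p - 1, p - 1) ≡ 1 (mod p ^ 3)`. -/
theorem choose_mul_add_pred_modEq_one (p : ℕ) (hp : p.Prime) (hp3 : 3 < p) (n : ℕ) :
    (((n * p + (p - 1)).choose (p - 1) : ℕ) : ℤ) ≡ 1 [ZMOD (p : ℤ) ^ 3] := by
  obtain ⟨g, hg⟩ := (risingProd (p - 1)).eval_eq_cubic_expansion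
  obtain ⟨t, ht⟩ := dvd_coeff_two_risingProd p hp hp3
  obtain ⟨s, hs⟩ := sq_dvd_coeff_one_risingProd p hp hp3
  have h1 := risingProd_eval_natCast (p - 1) (n * p)
  have h0 := risingProd_eval_natCast (p - 1) 0
  rw [hg, ht, hs, Nat.ascFactorial_eq_factorial_mul_choose] at h1
  rw [hg, zero_add, Nat.one_ascFactorial] at h0
  have hdvd : (p : ℤ) ^ 3 ∣
      ((p - 1).factorial : ℤ) * (((n * p + (p - 1)).choose (p - 1) : ℕ) - 1) := by
    refine ⟨s * n + t * n ^ 2 + n ^ 3 * g.eval ((n * p : ℕ) : ℤ), ?_⟩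
    push_cast at h0 h1 ⊢
    linear_combination h0 - h1
  have hcop : IsCoprime ((p : ℤ) ^ 3) ((p - 1).factorial : ℤ) := by
    refine IsCoprime.pow_left (Nat.isCoprime_iff_coprime.mpr ?_)
    exact hp.coprime_factorial_of_lt (by omega)
  exact (Int.modEq_iff_dvd.mpr (hcop.dvd_of_dvd_mul_left hdvd)).symm

/-- Each block (np+1)⋯(np+p-1) is (p-1)! times a binomial coefficient that is 1 mod p^3; the
multiples of p left over supply n! p^n. -/
theorem exists_factorial_mul_eq (p : ℕ) (hp : p.Prime) (hp3 : 3 < p) (n : ℕ) :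
    ∃ A : ℤ, A ≡ 1 [ZMOD (p : ℤ) ^ 3] ∧
      ((n * p).factorial : ℤ) = n.factorial * (p.factorial : ℤ) ^ n * A := by
  induction n with
  | zero => exact ⟨1, rfl, by simp⟩
  | succ n ih =>
    obtain ⟨A, hA, h⟩ := ih
    refine ⟨A * ((n * p + (p - 1)).choose (p - 1) : ℕ),
      by simpa using hA.mul (choose_mul_add_pred_modEq_one p hp hp3 n), ?_⟩
    have hp1 : p - 1 + 1 = p := by omega
    have e1 : ((n + 1) * p).factorial =
        (n + 1) * p * ((n * p).factorial *
          ((p - 1).factorial * (n * p + (p - 1)).choose (p - 1))) := by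
      rw [← Nat.ascFactorial_eq_factorial_mul_choose, Nat.factorial_mul_ascFactorial,
        show (n + 1) * p = (n * p + (p - 1)) + 1 by rw [add_assoc, hp1]; ring,
        Nat.factorial_succ]
    have e2 : p.factorial = p * (p - 1).factorial := (Nat.mul_factorial_pred hp.ne_zero).symm
    rw [e1, Nat.factorial_succ, pow_succ]
    push_cast
    rw [h]
    nth_rewrite 3 [e2]
    push_cast
    ring

/-! ### Arithmetic of p-integral rationals -/

/-- The ring `ℤ_(p)` of rationals whose denominator is not divisible by the prime `p`. -/
def pIntegral (p : ℕ) (hp : p.Prime) : Subring ℚ where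
  carrier := {c | ¬ p ∣ c.den}
  mul_mem' {a b} ha hb h := by
    rcases hp.dvd_mul.mp (h.trans (Rat.mul_den_dvd a b)) with h | h
    exacts [ha h, hb h]
  one_mem' := by simpa using hp.one_lt.ne'
  add_mem' {a b} ha hb h := by
    rcases hp.dvd_mul.mp (h.trans (Rat.add_den_dvd a b)) with h | h
    exacts [ha h, hb h]
  zero_mem' := by simpa using hp.one_lt.ne'
  neg_mem' {a} ha := by simpa using ha

theorem inv_mem_pIntegral {p : ℕ} (hp : p.Prime) {d : ℚ} (hd : d ≠ 0)
    (hpd : ¬ (p : ℤ) ∣ d.num) : d⁻¹ ∈ pIntegral p hp := by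
  change ¬ p ∣ (d⁻¹).den
  rw [Rat.den_inv_of_ne_zero hd]
  rwa [Int.natCast_dvd] at hpd

theorem exists_div_eq_one_add {p : ℕ} (hp : p.Prime) {A B : ℤ}
    (hA : A ≡ 1 [ZMOD (p : ℤ) ^ 3]) (hB : B ≡ 1 [ZMOD (p : ℤ) ^ 3]) :
    ∃ r ∈ pIntegral p hp, (A : ℚ) / B = 1 + (p : ℚ) ^ 3 * r := by
  have hpB : ¬ (p : ℤ) ∣ B := by
    intro h
    have h1 : (p : ℤ) ∣ 1 := (hB.of_dvd (dvd_pow_self _ three_ne_zero)).dvd_iff.mp h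
    exact hp.one_lt.ne' (by exact_mod_cast Int.eq_one_of_dvd_one (by positivity) h1)
  have hB0 : (B : ℚ) ≠ 0 := by
    rintro h
    exact hpB (by simp [Int.cast_eq_zero.mp h])
  obtain ⟨k, hk⟩ := (hB.trans hA.symm).dvd
  refine ⟨k * (B : ℚ)⁻¹, mul_mem (intCast_mem _ k)
    (inv_mem_pIntegral hp hB0 (by simpa using hpB)), ?_⟩
  have hk' : (A : ℚ) - B = (p : ℚ) ^ 3 * k := by exact_mod_cast hk
  field_simp
  linear_combination hk'

theorem fermatQuotient_mem_pIntegral {p : ℕ} (hp : p.Prime) {a : ℕ} (ha : ¬ p ∣ a) :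
    fermatQuotient p a ∈ pIntegral p hp := by
  have hcop : IsCoprime (a : ℤ) (p : ℤ) :=
    Nat.isCoprime_iff_coprime.mpr ((hp.coprime_iff_not_dvd.mpr ha).symm)
  obtain ⟨k, hk⟩ := (Int.ModEq.pow_card_sub_one_eq_one hp hcop).symm.dvd
  have hk' : (a : ℚ) ^ (p - 1) - 1 = p * k := by exact_mod_cast hk
  have hp0 : (p : ℚ) ≠ 0 := by exact_mod_cast hp.ne_zero
  have : fermatQuotient p a = k := by
    rw [fermatQuotient, Int.cast_natCast, hk', mul_div_cancel_left₀ _ hp0]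
  rw [this]
  exact intCast_mem _ k

theorem pow_pred_eq_one_add_fermatQuotient {p : ℕ} (hp : p.Prime) (a : ℤ) :
    (a : ℚ) ^ (p - 1) = 1 + p * fermatQuotient p a := by
  have hp0 : (p : ℚ) ≠ 0 := by exact_mod_cast hp.ne_zero
  rw [fermatQuotient, mul_div_cancel₀ _ hp0]
  ring

/-- If `r`, `a`, `b`, `e`, `w` are `p`-integral, then modulo `p ^ 4` the factor
`1 + p ^ 3 r` is trivial and `1 + p a + p ^ 2 b + p ^ 3 e` is inverse to
`1 - p a + p ^ 2 (a ^ 2 - b)`. -/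
theorem ratModPow_four_of_expansion {p : ℕ} (hp : p.Prime) {w r a b e : ℚ}
    (hw : w ∈ pIntegral p hp) (hr : r ∈ pIntegral p hp) (ha : a ∈ pIntegral p hp)
    (hb : b ∈ pIntegral p hp) (he : e ∈ pIntegral p hp) :
    RatModPow p 4 (w * (p * (2 * p - 1) * (1 + (p : ℚ) ^ 3 * r)))
      (w * (1 + p * a + (p : ℚ) ^ 2 * b + (p : ℚ) ^ 3 * e) *
        (p * ((2 * p - 1) * (1 - p * a) - (p : ℚ) ^ 2 * (a ^ 2 - b)))) := by
  let S := pIntegral p hp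
  have key (w r a b e : S) : ∃ c : S,
      w * (p * (2 * p - 1) * (1 + (p : S) ^ 3 * r)) -
      (w * (1 + p * a + (p : S) ^ 2 * b + (p : S) ^ 3 * e) *
        (p * ((2 * p - 1) * (1 - p * a) - (p : S) ^ 2 * (a ^ 2 - b)))) = (p : S) ^ 4 * c :=
    ⟨w * ((2 * p - 1) * r - (2 * (b - a ^ 2) - (2 * p - 1) * (a * b) - (a ^ 2 - b) * (a + p * b)
      + e * ((2 * p - 1) * (1 - p * a) - (p : S) ^ 2 * (a ^ 2 - b)))), by ring⟩
  obtain ⟨c, hc⟩ := key ⟨w, hw⟩ ⟨r, hr⟩ ⟨a, ha⟩ ⟨b, hb⟩ ⟨e, he⟩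
  refine ⟨c, c.2, ?_⟩
  have := congrArg (Subtype.val) hc
  push_cast at this
  exact this

/-! ### Telescoping sums -/

open Nat in
theorem sum_centralBinom_telescope (d : ℚ) (hd : d ≠ 0) (n : ℕ) :
    ∑ k ∈ Finset.range n,
        (1 + (4 - d) * (k : ℚ) ^ 2 + (8 + d) / 2 * (k : ℚ)) * (((2 * k).choose k : ℚ) / d ^ k) =
      n * (2 * n - 1) * (((2 * n).choose n : ℚ) / 2) * (d / d ^ n) := by
  have hc (k : ℕ) : ((2 * k).choose k : ℚ) = (2 * k)! / (k ! * k !) := by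
    rw [Nat.cast_choose ℚ (by omega : k ≤ 2 * k), show 2 * k - k = k by omega]
  simp only [hc]
  induction n with
  | zero => simp
  | succ n ih =>
    rw [Finset.sum_range_succ, ih, show 2 * (n + 1) = 2 * n + 1 + 1 by ring]
    simp only [Nat.factorial_succ]
    have := Nat.cast_ne_zero (R := ℚ).mpr (Nat.factorial_ne_zero n)
    push_cast
    field_simp
    ring

open Nat in
theorem sum_choose_three_telescope (d : ℚ) (hd : d ≠ 0) (n : ℕ) :
    ∑ k ∈ Finset.range n,
        (1 + (27 - 4 * d) / 6 * (k : ℚ) ^ 2 + (27 + 2 * d) / 6 * (k : ℚ)) *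
          (((3 * k).choose k : ℚ) / d ^ k) =
      n * (2 * n - 1) * (((3 * n).choose n : ℚ) / 3) * (d / d ^ n) := by
  have hc (k : ℕ) : ((3 * k).choose k : ℚ) = (3 * k)! / (k ! * (2 * k)!) := by
    rw [Nat.cast_choose ℚ (by omega : k ≤ 3 * k), show 3 * k - k = 2 * k by omega]
  simp only [hc]
  induction n with
  | zero => simp
  | succ n ih =>
    rw [Finset.sum_range_succ, ih, show 2 * (n + 1) = 2 * n + 1 + 1 by ring,
      show 3 * (n + 1) = 3 * n + 1 + 1 + 1 by ring]
    simp only [Nat.factorial_succ]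
    have := Nat.cast_ne_zero (R := ℚ).mpr (Nat.factorial_ne_zero n)
    have := Nat.cast_ne_zero (R := ℚ).mpr (Nat.factorial_ne_zero (2 * n))
    push_cast
    field_simp
    ring

open Nat in
theorem sum_choose_four_telescope (d : ℚ) (hd : d ≠ 0) (n : ℕ) :
    ∑ k ∈ Finset.range n,
        (1 + (16 - d) / 3 * (k : ℚ) ^ 2 + (32 + d) / 6 * (k : ℚ)) *
          (((4 * k).choose (2 * k) : ℚ) / d ^ k) =
      n * (2 * n - 1) * (((4 * n).choose (2 * n) : ℚ) / 6) * (d / d ^ n) := by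
  have hc (k : ℕ) : ((4 * k).choose (2 * k) : ℚ) = (4 * k)! / ((2 * k)! * (2 * k)!) := by
    rw [Nat.cast_choose ℚ (by omega : 2 * k ≤ 4 * k), show 4 * k - 2 * k = 2 * k by omega]
  simp only [hc]
  induction n with
  | zero => simp
  | succ n ih =>
    rw [Finset.sum_range_succ, ih, show 2 * (n + 1) = 2 * n + 1 + 1 by ring,
      show 4 * (n + 1) = 4 * n + 1 + 1 + 1 + 1 by ring]
    simp only [Nat.factorial_succ]
    have := Nat.cast_ne_zero (R := ℚ).mpr (Nat.factorial_ne_zero (2 * n))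
    push_cast
    field_simp
    ring

open Nat in
theorem choose_three_mul_choose_six_div (k : ℕ) :
    ((3 * k).choose k : ℚ) * ((6 * k).choose (3 * k) : ℚ) / ((2 * k).choose k : ℚ) =
      (6 * k)! * k ! / ((3 * k)! * (2 * k)! ^ 2) := by
  rw [Nat.cast_choose ℚ (by omega : k ≤ 3 * k), Nat.cast_choose ℚ (by omega : k ≤ 2 * k),
    Nat.cast_choose ℚ (by omega : 3 * k ≤ 6 * k), show 3 * k - k = 2 * k by omega,
    show 6 * k - 3 * k = 3 * k by omega, show 2 * k - k = k by omega]
  have := Nat.cast_ne_zero (R := ℚ).mpr (Nat.factorial_ne_zero k)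
  have := Nat.cast_ne_zero (R := ℚ).mpr (Nat.factorial_ne_zero (2 * k))
  have := Nat.cast_ne_zero (R := ℚ).mpr (Nat.factorial_ne_zero (3 * k))
  field_simp

open Nat in
theorem sum_choose_six_telescope (d : ℚ) (hd : d ≠ 0) (n : ℕ) :
    ∑ k ∈ Finset.range n,
        (1 + (108 - d) / 15 * (k : ℚ) ^ 2 + (216 + d) / 30 * (k : ℚ)) *
          (((3 * k).choose k : ℚ) * ((6 * k).choose (3 * k) : ℚ) /
            (d ^ k * ((2 * k).choose k : ℚ))) =
      n * (2 * n - 1) * ((6 * n)! * n ! / ((3 * n)! * (2 * n)! ^ 2) / 30) * (d / d ^ n) := by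
  have hc (k : ℕ) : ((3 * k).choose k : ℚ) * ((6 * k).choose (3 * k) : ℚ) /
      (d ^ k * ((2 * k).choose k : ℚ)) =
        (6 * k)! * k ! / ((3 * k)! * (2 * k)! ^ 2) / d ^ k := by
    rw [← choose_three_mul_choose_six_div, div_div, mul_comm (d ^ k)]
  simp only [hc]
  induction n with
  | zero => simp
  | succ n ih =>
    rw [Finset.sum_range_succ, ih, show 2 * (n + 1) = 2 * n + 1 + 1 by ring,
      show 3 * (n + 1) = 3 * n + 1 + 1 + 1 by ring,
      show 6 * (n + 1) = 6 * n + 1 + 1 + 1 + 1 + 1 + 1 by ring]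
    simp only [Nat.factorial_succ]
    have := Nat.cast_ne_zero (R := ℚ).mpr (Nat.factorial_ne_zero (2 * n))
    have := Nat.cast_ne_zero (R := ℚ).mpr (Nat.factorial_ne_zero (3 * n))
    push_cast
    field_simp
    ring

/-- The powers of p! cancel in each ratio, and the small factorials cancel against 2, 3, 6, 30,
leaving a quotient of integers that are 1 mod p^3. -/
theorem exists_factorial_ratios (p : ℕ) (hp : p.Prime) (hp3 : 3 < p) :
    (∃ r ∈ pIntegral p hp, ((2 * p).choose p : ℚ) / 2 = 1 + (p : ℚ) ^ 3 * r) ∧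
    (∃ r ∈ pIntegral p hp, ((3 * p).choose p : ℚ) / 3 = 1 + (p : ℚ) ^ 3 * r) ∧
    (∃ r ∈ pIntegral p hp, ((4 * p).choose (2 * p) : ℚ) / 6 = 1 + (p : ℚ) ^ 3 * r) ∧
    ∃ r ∈ pIntegral p hp, ((6 * p).factorial * p.factorial /
      ((3 * p).factorial * (2 * p).factorial ^ 2) / 30 : ℚ) = 1 + (p : ℚ) ^ 3 * r := by
  have hA (n : ℕ) : ∃ A : ℤ, A ≡ 1 [ZMOD (p : ℤ) ^ 3] ∧ (A : ℚ) ≠ 0 ∧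
      ((n * p).factorial : ℚ) = n.factorial * (p.factorial : ℚ) ^ n * A := by
    obtain ⟨A, hA, h⟩ := exists_factorial_mul_eq p hp hp3 n
    refine ⟨A, hA, ?_, by exact_mod_cast h⟩
    rw [Int.cast_ne_zero]
    rintro rfl
    exact Nat.factorial_ne_zero _ (by simpa using h)
  obtain ⟨A₂, m₂, n₂, h₂⟩ := hA 2
  obtain ⟨A₃, m₃, n₃, h₃⟩ := hA 3
  obtain ⟨A₄, m₄, n₄, h₄⟩ := hA 4
  obtain ⟨A₆, m₆, n₆, h₆⟩ := hA 6
  have hf : (p.factorial : ℚ) ≠ 0 := by exact_mod_cast p.factorial_ne_zero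
  have m₂₂ : A₂ ^ 2 ≡ 1 [ZMOD (p : ℤ) ^ 3] := by simpa using m₂.pow 2
  refine ⟨?_, ?_, ?_, ?_⟩
  · convert! exists_div_eq_one_add hp m₂ (Int.ModEq.refl 1) using 4
    rw [Nat.cast_choose ℚ (by omega : p ≤ 2 * p), show 2 * p - p = p by omega, h₂]
    simp [Nat.factorial]
    field_simp
  · convert! exists_div_eq_one_add hp m₃ m₂ using 4
    rw [Nat.cast_choose ℚ (by omega : p ≤ 3 * p), show 3 * p - p = 2 * p by omega, h₂, h₃]
    simp [Nat.factorial]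
    field_simp
    norm_num
  · convert! exists_div_eq_one_add hp m₄ m₂₂ using 4
    rw [Nat.cast_choose ℚ (by omega : 2 * p ≤ 4 * p), show 4 * p - 2 * p = 2 * p by omega, h₂, h₄]
    simp [Nat.factorial]
    field_simp
    norm_num
  · have m₃₂₂ : A₃ * A₂ ^ 2 ≡ 1 [ZMOD (p : ℤ) ^ 3] := by simpa using m₃.mul m₂₂
    convert! exists_div_eq_one_add hp m₆ m₃₂₂ using 4
    rw [h₂, h₃, h₆]
    simp [Nat.factorial]
    field_simp
    norm_num

theorem corollary1p2 (p : ℕ) (hp : p.Prime) (hp3 : 3 < p)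
    (d : ℚ) (hd : d ≠ 0) (hpd : ¬ (p : ℤ) ∣ d.num) :
    RatModPow p 4
      (∑ k ∈ Finset.range p,
        (1 + (4 - d) * (k : ℚ) ^ 2 + (8 + d) / 2 * (k : ℚ)) *
          (((2 * k).choose k : ℚ) / d ^ k))
      ((16 / d) ^ (p - 1) *
        ((p : ℚ) * (2 * (p : ℚ) - 1) * (1 - 4 * (p : ℚ) * fermatQuotient p 2)
          - 10 * (p : ℚ) ^ 3 * fermatQuotient p 2 ^ 2)) ∧
    RatModPow p 4
      (∑ k ∈ Finset.range p,
        (1 + (27 - 4 * d) / 6 * (k : ℚ) ^ 2 + (27 + 2 * d) / 6 * (k : ℚ)) *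
          (((3 * k).choose k : ℚ) / d ^ k))
      ((-(27 / d)) ^ (p - 1) * (p : ℚ) *
        ((2 * (p : ℚ) - 1) * (1 - 3 * (p : ℚ) * fermatQuotient p 3)
          - 6 * (p : ℚ) ^ 2 * fermatQuotient p 3 ^ 2)) ∧
    RatModPow p 4
      (∑ k ∈ Finset.range p,
        (1 + (16 - d) / 3 * (k : ℚ) ^ 2 + (32 + d) / 6 * (k : ℚ)) *
          (((4 * k).choose (2 * k) : ℚ) / d ^ k))
      ((-(64 / d)) ^ (p - 1) * (p : ℚ) *
        ((2 * (p : ℚ) - 1) * (1 - 6 * (p : ℚ) * fermatQuotient p 2)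
          - 21 * (p : ℚ) ^ 2 * fermatQuotient p 2 ^ 2)) ∧
    RatModPow p 4
      (∑ k ∈ Finset.range p,
        (1 + (108 - d) / 15 * (k : ℚ) ^ 2 + (216 + d) / 30 * (k : ℚ)) *
          (((3 * k).choose k : ℚ) * ((6 * k).choose (3 * k) : ℚ) /
            (d ^ k * ((2 * k).choose k : ℚ))))
      ((-(432 / d)) ^ (p - 1) * (p : ℚ) *
        ((2 * (p : ℚ) - 1) *
            (1 - 4 * (p : ℚ) * fermatQuotient p 2 - 3 * (p : ℚ) * fermatQuotient p 3)
          - 2 * (p : ℚ) ^ 2 *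
            (5 * fermatQuotient p 2 ^ 2 + 6 * fermatQuotient p 2 * fermatQuotient p 3
              + 3 * fermatQuotient p 3 ^ 2))) := by
  have heven : Even (p - 1) := hp.even_sub_one (by omega)
  have hw : (d ^ (p - 1))⁻¹ ∈ pIntegral p hp :=
    inv_pow d (p - 1) ▸ pow_mem (inv_mem_pIntegral hp hd hpd) _
  have hq2 : fermatQuotient p 2 ∈ pIntegral p hp :=
    fermatQuotient_mem_pIntegral hp (a := 2) fun h => by have := Nat.le_of_dvd two_pos h; omega
  have hq3 : fermatQuotient p 3 ∈ pIntegral p hp :=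
    fermatQuotient_mem_pIntegral hp (a := 3) fun h => by have := Nat.le_of_dvd three_pos h; omega
  have e2 : (2 : ℚ) ^ (p - 1) = 1 + p * fermatQuotient p 2 :=
    mod_cast pow_pred_eq_one_add_fermatQuotient hp 2
  have e3 : (3 : ℚ) ^ (p - 1) = 1 + p * fermatQuotient p 3 :=
    mod_cast pow_pred_eq_one_add_fermatQuotient hp 3
  have hdw : d / d ^ p = (d ^ (p - 1))⁻¹ := by
    obtain ⟨m, rfl⟩ : ∃ m, p = m + 1 := ⟨p - 1, by omega⟩
    rw [Nat.add_sub_cancel, pow_succ]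
    field_simp
  have hpow (i j : ℕ) : ((2 ^ i * 3 ^ j : ℚ) / d) ^ (p - 1) = (d ^ (p - 1))⁻¹ *
      ((1 + p * fermatQuotient p 2) ^ i * (1 + p * fermatQuotient p 3) ^ j) := by
    rw [← e2, ← e3, div_eq_mul_inv, mul_pow, mul_pow, ← pow_mul, ← pow_mul, ← pow_mul, ← pow_mul,
      mul_comm i, mul_comm j, inv_pow]
    ring
  have h16 := hpow 4 0
  have h27 := hpow 0 3
  have h64 := hpow 6 0
  have h432 := hpow 4 3
  norm_num at h16 h27 h64 h432
  obtain ⟨⟨r₁, hr₁, h₁⟩, ⟨r₂, hr₂, h₂⟩, ⟨r₃, hr₃, h₃⟩, r₄, hr₄, h₄⟩ :=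
    exists_factorial_ratios p hp hp3
  rw [sum_centralBinom_telescope d hd, sum_choose_three_telescope d hd,
    sum_choose_four_telescope d hd, sum_choose_six_telescope d hd, h₁, h₂, h₃, h₄, hdw,
    heven.neg_pow, heven.neg_pow, heven.neg_pow, h16, h27, h64, h432]
  generalize fermatQuotient p 2 = x at *
  generalize fermatQuotient p 3 = y at *
  generalize (d ^ (p - 1))⁻¹ = w at *
  have hnum (n : ℕ) [n.AtLeastTwo] :
      ((ofNat(n) : pIntegral p hp) : ℚ) = ofNat(n) := rfl
  have key {r a b e : ℚ} (hr : r ∈ pIntegral p hp) (ha : a ∈ pIntegral p hp)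
      (hb : b ∈ pIntegral p hp) (he : e ∈ pIntegral p hp) :=
    ratModPow_four_of_expansion hp hw hr ha hb he
  lift x to pIntegral p hp using hq2
  lift y to pIntegral p hp using hq3
  refine ⟨?_, ?_, ?_, ?_⟩
  -- In each case a, b, e come from expanding (1+px)^i (1+py)^j in explicit powers of p, with e
  -- collecting everything from p^3 on; a^2 - b yields the constants 10, 6, 21 and the last
  -- quadratic form.
  · convert! key hr₁ (4 * x).2 (6 * x ^ 2).2 (4 * x ^ 3 + p * x ^ 4).2 using 1
    · ring
    · simp only [Subring.coe_add, Subring.coe_mul, Subring.coe_pow, Subring.coe_natCast, hnum]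
      ring
  · convert! key hr₂ (3 * y).2 (3 * y ^ 2).2 (y ^ 3).2 using 1
    · ring
    · simp only [Subring.coe_mul, Subring.coe_pow, hnum]
      ring
  · convert! key hr₃ (6 * x).2 (15 * x ^ 2).2
      (20 * x ^ 3 + 15 * p * x ^ 4 + 6 * p ^ 2 * x ^ 5 + p ^ 3 * x ^ 6).2 using 1
    · ring
    · simp only [Subring.coe_add, Subring.coe_mul, Subring.coe_pow, Subring.coe_natCast, hnum]
      ring
  · convert! key hr₄ (4 * x + 3 * y).2 (6 * x ^ 2 + 12 * x * y + 3 * y ^ 2).2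
      ((4 * x ^ 3 + p * x ^ 4) * (1 + p * y) ^ 3 + 18 * x ^ 2 * y + 12 * x * y ^ 2 + y ^ 3
        + p * (18 * x ^ 2 * y ^ 2 + 4 * x * y ^ 3) + p ^ 2 * (6 * x ^ 2 * y ^ 3)).2 using 1
    · ring
    · simp only [Subring.coe_add, Subring.coe_mul, Subring.coe_pow, Subring.coe_natCast,
        Subring.coe_one, hnum]
      ring
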